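/- Let $d,K,N,M$ be positive integers with $M\le K$. Let $$P(\mathbf x)=\sum_{\mathbf k\in(\mathbb Z\cap[-K,K])^d}c_{\mathbf k}\,e^{2\pi i\mathbf k\cdot\mathbf x/N},\qquad \mathbf x\in\mathbb R^d,$$ be a real-valued trigonometric polynomial such that $c_{\mathbf k}=N^{-d}\delta_{\mathbf k,\mathbf 0}$ for all $\mathbf k\in(N\mathbb Z)^d\cap[-K,K]^d$ and such that $P\chi_{[0,N]^d}\in C^{2M-1}(\mathbb R^d)$. Suppose that $$P(\mathbf x)=\Big(\prod_{\ell=1}^d\sin^{2M}(\pi x_\ell/N)\Big)G(\mathbf x)H(\mathbf x),\qquad \mathbf x\in\mathbb R^d,$$ for real-valued $(N\mathbb Z)^d$-periodic trigonometric polynomials $G,H$. Let $B$ be a real invertible $d\times d$ matrix such that $B^{-1}$ has integer entries and $(B^{T})^{-1}\mathbf n\notin(-N,N)^d$ for all $\mathbf n\in\mathbb Z^d\setminus\{\mathbf 0\}$. For $\mathbf j\in\mathbb Z^d$ put $$g(\mathbf j)=\Big(\prod_{\ell=1}^d\sin^{M}(\pi j_\ell/N)\Big)G(\mathbf j)\chi_{[0,N]^d}(\mathbf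 j),\qquad h(\mathbf j)=|\det B|\Big(\prod_{\ell=1}^d\sin^{M}(\pi j_\ell/N)\Big)H(\mathbf j)\chi_{[0,N]^d}(\mathbf j).$$ Then $g,h\in\ell^2(\mathbb Z^d)$. Moreover, let $\Omega\subset\mathbb Z^d$ be any set of coset representatives of $\mathbb Z^d/B^{-1}\mathbb Z^d$, and for a sequence $c\in\ell^2(\mathbb Z^d)$ put $c_{\mathbf m,\mathbf n}(\mathbf j)=e^{2\pi i B\mathbf m\cdot\mathbf j}c(\mathbf j-\mathbf n)$. Then the discrete Gabor systems $\{g_{\mathbf m,\mathbf n}\}_{\mathbf m\in\Omega,\,\mathbf n\in\mathbb Z^d}$ and $\{h_{\mathbf m,\mathbf n}\}_{\mathbf m\in\Omega,\,\mathbf n\in\mathbb Z^d}$ form dual frames for $\ell^2(\mathbb Z^d)$: both are frames, and every $f\in\ell^2(\mathbb Z^d)$ satisfies, with unconditional convergence in $\ell^2(\mathbb Z^d)$, $$f=\sum_{\mathbf m\in\Omega,\,\mathbf n\in\mathbb Z^d}\langle f,g_{\mathbf m,\mathbf n}\rangle h_{\mathbf m,\mathbf n}=\sum_{\mathbf m\in\Omega,\,\mathbf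 n\in\mathbb Z^d}\langle f,h_{\mathbf m,\mathbf n}\rangle g_{\mathbf m,\mathbf n}.$$ -/

import Mathlib

open scoped ENNReal

noncomputable section

namespace DiscreteGabor

/-- An integer point of `ℤ^d`, viewed as a point of `ℝ^d`. -/
def toReal {d : ℕ} (j : Fin d → ℤ) : Fin d → ℝ := fun i => (j i : ℝ)

/-! ### Trigonometric polynomials and windows -/

/-- The `(Nℤ)^d`-periodic character `x ↦ exp(2πi k·x / N)` on `ℝ^d`. -/
def trigChar {d : ℕ} (N : ℕ) (k : Fin d → ℤ) (x : Fin d → ℝ) : ℂ :=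
  Complex.exp (2 * Real.pi * Complex.I * ((toReal k ⬝ᵥ x : ℝ) : ℂ) / (N : ℂ))

/-- `F` is a real-valued `(Nℤ)^d`-periodic trigonometric polynomial: a finite linear combination,
with complex coefficients, of the characters `exp(2πi k·x / N)`, `k ∈ ℤ^d`, whose values on `ℝ^d`
are all real. -/
def IsRealTrigPoly {d : ℕ} (N : ℕ) (F : (Fin d → ℝ) → ℝ) : Prop :=
  ∃ (s : Finset (Fin d → ℤ)) (a : (Fin d → ℤ) → ℂ),
    ∀ x, (F x : ℂ) = ∑ k ∈ s, a k * trigChar N k x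

/-- The cube `[0,N]^d` in `ℝ^d`. -/
def cube (d N : ℕ) : Set (Fin d → ℝ) := {x | ∀ i, 0 ≤ x i ∧ x i ≤ N}

/-- The open cube `(-N,N)^d` in `ℝ^d`. -/
def openCube (d N : ℕ) : Set (Fin d → ℝ) := {x | ∀ i, -(N : ℝ) < x i ∧ x i < N}

/-- The window `x ↦ (∏ⱼ sin^M(π xⱼ / N)) F(x) χ_{[0,N]^d}(x)` on `ℝ^d`. -/
def window {d : ℕ} (M N : ℕ) (F : (Fin d → ℝ) → ℝ) : (Fin d → ℝ) → ℝ :=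
  (cube d N).indicator fun x => (∏ i, Real.sin (Real.pi * x i / N) ^ M) * F x

/-- The sequence of integer samples of a function on `ℝ^d`, as a complex sequence on `ℤ^d`. -/
def samples {d : ℕ} (f : (Fin d → ℝ) → ℝ) : (Fin d → ℤ) → ℂ := fun j => (f (toReal j) : ℂ)

/-! ### Frames and dual frames in a Hilbert space

Mathlib's `inner ℂ x y` is conjugate linear in `x`, so `inner ℂ (f i) x` is the frame
coefficient `⟨x, f i⟩` of the convention that is linear in the first variable. -/

section Frames

variable {ι E : Type*} [NormedAddCommGroup E] [InnerProductSpace ℂ E]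

/-- `f` is a frame: there are bounds `0 < a, b` such that
`a ‖x‖² ≤ ∑ᵢ |⟨x, f i⟩|² ≤ b ‖x‖²` for every `x`. -/
def IsFrame (f : ι → E) : Prop :=
  ∃ a b : ℝ, 0 < a ∧ 0 < b ∧ ∀ x : E,
    Summable (fun i => ‖inner ℂ (f i) x‖ ^ 2) ∧
    a * ‖x‖ ^ 2 ≤ ∑' i, ‖inner ℂ (f i) x‖ ^ 2 ∧
    ∑' i, ‖inner ℂ (f i) x‖ ^ 2 ≤ b * ‖x‖ ^ 2

/-- `f` and `g` are dual frames: both are frames, and every `x` has the (unconditionally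
convergent) expansions `x = ∑ᵢ ⟨x, f i⟩ g i = ∑ᵢ ⟨x, g i⟩ f i`. -/
def IsDualFrames (f g : ι → E) : Prop :=
  IsFrame f ∧ IsFrame g ∧
    (∀ x : E, HasSum (fun i => inner ℂ (f i) x • g i) x) ∧
    (∀ x : E, HasSum (fun i => inner ℂ (g i) x • f i) x)

end Frames

/-! ### Discrete Gabor systems -/

/-- The Hilbert space `ℓ²(ℤ^d)` of complex sequences. -/
abbrev ellTwo (d : ℕ) : Type := lp (fun _ : Fin d → ℤ => ℂ) 2

/-- The sequence `j ↦ exp(2πi (B m)·j) c(j - n)`. -/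
def gaborSeq {d : ℕ} (B : Matrix (Fin d) (Fin d) ℝ) (c : (Fin d → ℤ) → ℂ)
    (m n : Fin d → ℤ) : (Fin d → ℤ) → ℂ := fun j =>
  Complex.exp (2 * Real.pi * Complex.I * ((B.mulVec (toReal m) ⬝ᵥ toReal j : ℝ) : ℂ)) * c (j - n)

theorem norm_gaborSeq {d : ℕ} (B : Matrix (Fin d) (Fin d) ℝ) (c : (Fin d → ℤ) → ℂ)
    (m n j : Fin d → ℤ) : ‖gaborSeq B c m n j‖ = ‖c (j - n)‖ := by
  have h : ∀ t : ℝ, ‖Complex.exp (2 * Real.pi * Complex.I * (t : ℂ))‖ = 1 := by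
    intro t
    rw [Complex.norm_exp]
    simp
  rw [gaborSeq, norm_mul, h, one_mul]

theorem memℓp_gaborSeq {d : ℕ} (B : Matrix (Fin d) (Fin d) ℝ) {c : (Fin d → ℤ) → ℂ}
    (hc : Memℓp c 2) (m n : Fin d → ℤ) : Memℓp (gaborSeq B c m n) 2 := by
  have h2 : 0 < (2 : ℝ≥0∞).toReal := by norm_num
  rw [memℓp_gen_iff h2] at hc ⊢
  simp only [norm_gaborSeq]
  exact hc.comp_injective (Equiv.subRight n).injective

/-- The subgroup `B⁻¹ ℤ^d` of `ℤ^d` (when `B⁻¹` has integer entries; in general this is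
`B⁻¹ ℤ^d ∩ ℤ^d`). -/
def latticeSubgroup {d : ℕ} (B : Matrix (Fin d) (Fin d) ℝ) : AddSubgroup (Fin d → ℤ) where
  carrier := {z | ∃ k : Fin d → ℤ, toReal z = B⁻¹.mulVec (toReal k)}
  zero_mem' := ⟨0, by
    have h : toReal (0 : Fin d → ℤ) = 0 := by ext i; simp [toReal]
    rw [h, Matrix.mulVec_zero]⟩
  add_mem' := by
    rintro y z ⟨k, hk⟩ ⟨l, hl⟩
    have h : ∀ u v : Fin d → ℤ, toReal (u + v) = toReal u + toReal v := by
      intro u v; ext i; simp [toReal]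
    exact ⟨k + l, by rw [h, h, Matrix.mulVec_add, hk, hl]⟩
  neg_mem' := by
    rintro z ⟨k, hk⟩
    have h : ∀ u : Fin d → ℤ, toReal (-u) = -toReal u := by
      intro u; ext i; simp [toReal]
    exact ⟨-k, by rw [h, h, Matrix.mulVec_neg, hk]⟩

/-- `Ω` is a set of coset representatives of `ℤ^d / B⁻¹ℤ^d`: every element of `ℤ^d` is in exactly
one way a sum of an element of `Ω` and an element of `B⁻¹ℤ^d`. -/
def IsCosetReps {d : ℕ} (B : Matrix (Fin d) (Fin d) ℝ) (Ω : Set (Fin d → ℤ)) : Prop :=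
  AddSubgroup.IsComplement Ω (latticeSubgroup B : Set (Fin d → ℤ))

/-- The discrete Gabor system in `ℓ²(ℤ^d)` generated by `c ∈ ℓ²(ℤ^d)` and `B`. Its members are
the sequences `j ↦ exp(2πi (B m)·j) c(j - n)`, indexed by `n ∈ ℤ^d` and by one `m` from each coset
of `ℤ^d / B⁻¹ℤ^d` (on `ℤ^d` the modulation depends only on the coset of `m`). -/
def gaborSystem {d : ℕ} (B : Matrix (Fin d) (Fin d) ℝ) (Ω : Set (Fin d → ℤ))
    (c : (Fin d → ℤ) → ℂ) (hc : Memℓp c 2) (p : Ω × (Fin d → ℤ)) : ellTwo d :=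
  ⟨gaborSeq B c p.1 p.2, memℓp_gaborSeq B hc p.1 p.2⟩

end DiscreteGabor

end

/-! The sine factors vanish on the faces `j i = N`, so both windows live on the box `[0,N)^d`. With
`n = j - t`, the `j`-th coordinate of the Gabor expansion is a sum over `s`, `t` in the box of `v t
* conj (u s) * x (s + j - t)` times the modulation sum `∑ m, exp (2πi Bm·(t - s))`. Differences of
box points lie in `(-N,N)^d`. There the sharpness hypothesis makes `m ↦ exp (2πi Bm·l)`, for `l ≠
0`, a nontrivial character of the finite group `ℤ^d / B⁻¹ℤ^d`, so its sum is zero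
(`sum_modulation_eq_zero`). Only `s = t` survives, leaving `|Ω| * (∑ v * conj u) * x j`. This equals
`x j`, because `|Ω| = 1/|det B|` (`index_latticeSubgroup`) and the coefficient condition gives `∑ P
= 1` over the box (`sum_box_eq_one`). Finite supports make both systems Bessel, which upgrades the
coordinatewise identity to unconditional convergence and yields the lower frame bounds. -/

noncomputable section
namespace DiscreteGabor

/-! ### Bessel sequences: synthesis, and frames from a dual expansion. -/

section Bessel

variable {ι E : Type*} [NormedAddCommGroup E] [InnerProductSpace ℂ E]

/-- `f` is a Bessel sequence with bound `b`. -/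
def IsBessel (f : ι → E) (b : ℝ) : Prop :=
  0 < b ∧ ∀ x : E, Summable (fun i => ‖inner ℂ (f i) x‖ ^ 2) ∧
    ∑' i, ‖inner ℂ (f i) x‖ ^ 2 ≤ b * ‖x‖ ^ 2

/-- Pair `y` with itself, apply Cauchy–Schwarz and the Bessel bound at `y`, then cancel one factor
`‖y‖ ^ 2`. -/
theorem IsBessel.norm_sum_smul_sq_le {f : ι → E} {b : ℝ} (hf : IsBessel f b) (s : Finset ι)
    (c : ι → ℂ) : ‖∑ i ∈ s, c i • f i‖ ^ 2 ≤ b * ∑ i ∈ s, ‖c i‖ ^ 2 := by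
  set y := ∑ i ∈ s, c i • f i with hy
  have h1 : ‖y‖ ^ 2 ≤ ∑ i ∈ s, ‖c i‖ * ‖inner ℂ (f i) y‖ := by
    have h : inner ℂ y y = ∑ i ∈ s, (starRingEnd ℂ) (c i) * inner ℂ (f i) y := by
      conv_lhs => rw [hy, sum_inner]
      simp_rw [inner_smul_left, ← hy]
    have h' : ‖y‖ ^ 2 = ‖(inner ℂ y y : ℂ)‖ := by
      rw [inner_self_eq_norm_sq_to_K]; simp
    rw [h', h]
    refine (norm_sum_le _ _).trans_eq (Finset.sum_congr rfl fun i _ => ?_)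
    rw [norm_mul, RCLike.norm_conj]
  have h2 := Finset.sum_mul_sq_le_sq_mul_sq s (fun i => ‖c i‖) (fun i => ‖inner ℂ (f i) y‖)
  have h3 : ∑ i ∈ s, ‖inner ℂ (f i) y‖ ^ 2 ≤ b * ‖y‖ ^ 2 :=
    ((hf.2 y).1.sum_le_tsum s fun _ _ => by positivity).trans (hf.2 y).2
  have hc : 0 ≤ ∑ i ∈ s, ‖c i‖ ^ 2 := Finset.sum_nonneg fun _ _ => by positivity
  have h4 : (‖y‖ ^ 2) ^ 2 ≤ (∑ i ∈ s, ‖c i‖ ^ 2) * (b * ‖y‖ ^ 2) :=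
    (pow_le_pow_left₀ (by positivity) h1 2).trans
      (h2.trans (mul_le_mul_of_nonneg_left h3 hc))
  rcases (sq_nonneg ‖y‖).eq_or_lt with h0 | h0
  · rw [← h0]; exact mul_nonneg hf.1.le hc
  · refine le_of_mul_le_mul_right ?_ h0
    calc ‖y‖ ^ 2 * ‖y‖ ^ 2 = (‖y‖ ^ 2) ^ 2 := by ring
      _ ≤ _ := h4
      _ = _ := by ring

theorem IsBessel.summable_smul [CompleteSpace E] {f : ι → E} {b : ℝ} (hf : IsBessel f b)
    {c : ι → ℂ} (hc : Summable fun i => ‖c i‖ ^ 2) : Summable fun i => c i • f i := by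
  rw [summable_iff_vanishing_norm] at hc ⊢
  intro ε hε
  obtain ⟨s, hs⟩ := hc (ε ^ 2 / b) (div_pos (by positivity) hf.1)
  refine ⟨s, fun t ht => ?_⟩
  have h1 := hs t ht
  have h2 := hf.norm_sum_smul_sq_le t c
  rw [Real.norm_of_nonneg (Finset.sum_nonneg fun _ _ => by positivity), lt_div_iff₀ hf.1] at h1
  exact lt_of_pow_lt_pow_left₀ 2 hε.le (by linarith)

/-- The lower bound for `f` comes from the synthesis bound for `g`, applied to partial sums of the
expansion and passed to the limit. -/
theorem IsBessel.isFrame {f g : ι → E} {b b' : ℝ} (hf : IsBessel f b) (hg : IsBessel g b')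
    (h : ∀ x : E, HasSum (fun i => inner ℂ (f i) x • g i) x) : IsFrame f := by
  refine ⟨1 / b', b, one_div_pos.2 hg.1, hf.1, fun x => ⟨(hf.2 x).1, ?_, (hf.2 x).2⟩⟩
  have h1 : ‖x‖ ^ 2 ≤ b' * ∑' i, ‖inner ℂ (f i) x‖ ^ 2 := by
    refine le_of_tendsto (((h x).norm).pow 2) (Filter.Eventually.of_forall fun s => ?_)
    refine (hg.norm_sum_smul_sq_le s fun i => inner ℂ (f i) x).trans ?_
    exact mul_le_mul_of_nonneg_left ((hf.2 x).1.sum_le_tsum s fun _ _ => by positivity) hg.1.le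
  rw [one_div_mul_eq_div, div_le_iff₀ hg.1]
  linarith

end Bessel

/-! ### Gabor systems with finitely supported windows. -/

section Gabor

variable {d : ℕ}

/-- The frame coefficients of a Gabor system with finitely supported window are finite sums. -/
theorem inner_gaborSystem (B : Matrix (Fin d) (Fin d) ℝ) (Ω : Set (Fin d → ℤ))
    {c : (Fin d → ℤ) → ℂ} (hc : Memℓp c 2) {S : Finset (Fin d → ℤ)} (hS : ∀ j ∉ S, c j = 0)
    (p : Ω × (Fin d → ℤ)) (x : ellTwo d) :
    inner ℂ (gaborSystem B Ω c hc p) x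
      = ∑ s ∈ S, (starRingEnd ℂ) (gaborSeq B c p.1 p.2 (s + p.2)) * x (s + p.2) := by
  rw [lp.inner_eq_tsum, ← (Equiv.addRight p.2).tsum_eq, tsum_eq_sum (s := S)]
  · refine Finset.sum_congr rfl fun s _ => ?_
    simp [gaborSystem, mul_comm]
  · intro s hs
    simp [gaborSystem, gaborSeq, hS s hs]

theorem norm_inner_gaborSystem_sq_le (B : Matrix (Fin d) (Fin d) ℝ) (Ω : Set (Fin d → ℤ))
    {c : (Fin d → ℤ) → ℂ} (hc : Memℓp c 2) {S : Finset (Fin d → ℤ)} (hS : ∀ j ∉ S, c j = 0)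
    (p : Ω × (Fin d → ℤ)) (x : ellTwo d) :
    ‖inner ℂ (gaborSystem B Ω c hc p) x‖ ^ 2
      ≤ (∑ s ∈ S, ‖c s‖ ^ 2) * ∑ s ∈ S, ‖x (s + p.2)‖ ^ 2 := by
  rw [inner_gaborSystem B Ω hc hS]
  refine le_trans ?_ (Finset.sum_mul_sq_le_sq_mul_sq S (fun s => ‖c s‖) fun s => ‖x (s + p.2)‖)
  refine pow_le_pow_left₀ (norm_nonneg _) ((norm_sum_le _ _).trans_eq ?_) 2
  refine Finset.sum_congr rfl fun s _ => ?_
  rw [norm_mul, RCLike.norm_conj, norm_gaborSeq, add_sub_cancel_right]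

theorem hasSum_norm_sq (x : ellTwo d) : HasSum (fun j => ‖x j‖ ^ 2) (‖x‖ ^ 2) := by
  have h := lp.hasSum_norm (p := 2) (by norm_num) x
  simpa using h

/-- Each coefficient sees `x` only on `S + n`, and summing over `n` counts every `‖x j‖ ^ 2` exactly
`S.card` times. -/
theorem isBessel_gaborSystem (B : Matrix (Fin d) (Fin d) ℝ) (Ω : Set (Fin d → ℤ)) [Finite Ω]
    {c : (Fin d → ℤ) → ℂ} (hc : Memℓp c 2) {S : Finset (Fin d → ℤ)} (hS : ∀ j ∉ S, c j = 0) :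
    ∃ b, IsBessel (gaborSystem B Ω c hc) b := by
  have := Fintype.ofFinite Ω
  have hC : 0 ≤ ∑ s ∈ S, ‖c s‖ ^ 2 := Finset.sum_nonneg fun _ _ => by positivity
  set C := ∑ s ∈ S, ‖c s‖ ^ 2
  -- The `+ 1` keeps the bound positive even when `C`, `S` or `Ω` is trivial.
  refine ⟨Fintype.card Ω * (C * S.card) + 1, by positivity, fun x => ?_⟩
  have h1 : HasSum (fun n => C * ∑ s ∈ S, ‖x (s + n)‖ ^ 2) (C * ∑ _s ∈ S, ‖x‖ ^ 2) :=
    (hasSum_sum fun s _ => (Equiv.addLeft s).hasSum_iff.2 (hasSum_norm_sq x)).mul_left C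
  have h2 : HasSum (fun p : Ω × (Fin d → ℤ) => C * ∑ s ∈ S, ‖x (s + p.2)‖ ^ 2)
      (Fintype.card Ω * (C * ∑ _s ∈ S, ‖x‖ ^ 2)) := by
    have h0 : HasSum (fun _ : Ω => (1 : ℝ)) (Fintype.card Ω) := by
      simpa using hasSum_fintype fun _ : Ω => (1 : ℝ)
    have h3 := h0.mul h1 (h0.summable.mul_of_nonneg h1.summable (fun _ => zero_le_one)
      fun n => mul_nonneg hC (Finset.sum_nonneg fun _ _ => by positivity))
    simpa using h3
  have hle := fun p => norm_inner_gaborSystem_sq_le B Ω hc hS p x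
  have h4 : Summable fun p => ‖inner ℂ (gaborSystem B Ω c hc p) x‖ ^ 2 :=
    Summable.of_nonneg_of_le (fun _ => by positivity) hle h2.summable
  refine ⟨h4, (h4.tsum_le_tsum hle h2.summable).trans ?_⟩
  rw [h2.tsum_eq, Finset.sum_const, nsmul_eq_mul]
  nlinarith [sq_nonneg ‖x‖]

/-- The unimodular factors of the Gabor expansion combine to a single modulation. -/
theorem conj_exp_mul_exp (B : Matrix (Fin d) (Fin d) ℝ) (m s t j : Fin d → ℤ) :
    (starRingEnd ℂ) (Complex.exp (2 * Real.pi * Complex.I *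
        ((B.mulVec (toReal m) ⬝ᵥ toReal (s + (j - t)) : ℝ) : ℂ))) *
      Complex.exp (2 * Real.pi * Complex.I * ((B.mulVec (toReal m) ⬝ᵥ toReal j : ℝ) : ℂ))
    = Complex.exp (2 * Real.pi * Complex.I *
        ((B.mulVec (toReal m) ⬝ᵥ toReal (t - s) : ℝ) : ℂ)) := by
  have h : toReal (t - s) = toReal j - toReal (s + (j - t)) := by
    ext i; simp [toReal]; ring
  rw [← Complex.exp_conj, ← Complex.exp_add, h, dotProduct_sub]
  congr 1
  simp only [map_mul, Complex.conj_I, Complex.conj_ofReal, Complex.ofReal_sub, map_ofNat]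
  ring

/-- The Gabor expansion holds when the windows are supported in `S`, the modulations are orthogonal
on differences of points of `S`, and the windows are suitably normalized. -/
theorem hasSum_gaborSystem (B : Matrix (Fin d) (Fin d) ℝ) (Ω : Set (Fin d → ℤ)) [Fintype Ω]
    {u v : (Fin d → ℤ) → ℂ} (hu : Memℓp u 2) (hv : Memℓp v 2) {S : Finset (Fin d → ℤ)}
    (huS : ∀ j ∉ S, u j = 0) (hvS : ∀ j ∉ S, v j = 0)
    (horth : ∀ s ∈ S, ∀ t ∈ S, s ≠ t → ∑ m : Ω, Complex.exp (2 * Real.pi * Complex.I *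
      ((B.mulVec (toReal (m : Fin d → ℤ)) ⬝ᵥ toReal (t - s) : ℝ) : ℂ)) = 0)
    (huv : (Fintype.card Ω : ℂ) * ∑ s ∈ S, v s * (starRingEnd ℂ) (u s) = 1) (x : ellTwo d) :
    HasSum (fun p => inner ℂ (gaborSystem B Ω u hu p) x • gaborSystem B Ω v hv p) x := by
  obtain ⟨b, hb⟩ := isBessel_gaborSystem B Ω hu huS
  obtain ⟨b', hb'⟩ := isBessel_gaborSystem B Ω hv hvS
  have hsum := hb'.summable_smul (hb.2 x).1
  convert hsum.hasSum using 1
  ext j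
  -- Convergence is already known; continuity of evaluation lets the limit be identified
  -- coordinatewise.
  have hj := (hsum.hasSum.mapL (lp.evalCLM ℂ (fun _ : Fin d → ℤ => ℂ) 2 j))
  refine HasSum.unique ?_ hj
  -- With `n = j - t` the synthesis window is read at `t`, so only finitely many terms are nonzero.
  rw [← ((Equiv.refl Ω).prodCongr (Equiv.subLeft j)).hasSum_iff]
  have hterm : ∀ (m : Ω) (t : Fin d → ℤ),
      lp.evalCLM ℂ (fun _ : Fin d → ℤ => ℂ) 2 j
        (inner ℂ (gaborSystem B Ω u hu (m, j - t)) x • gaborSystem B Ω v hv (m, j - t))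
      = ∑ s ∈ S, v t * (starRingEnd ℂ) (u s) * x (s + (j - t)) *
          Complex.exp (2 * Real.pi * Complex.I *
            ((B.mulVec (toReal (m : Fin d → ℤ)) ⬝ᵥ toReal (t - s) : ℝ) : ℂ)) := by
    intro m t
    rw [inner_gaborSystem B Ω hu huS, map_smul, smul_eq_mul, Finset.sum_mul]
    refine Finset.sum_congr rfl fun s _ => ?_
    change _ * gaborSeq B v m (j - t) j = _
    rw [← conj_exp_mul_exp B m s t j]
    simp only [gaborSeq, map_mul, add_sub_cancel_right, sub_sub_cancel]
    ring
  have hzero : ∀ q ∉ (Finset.univ : Finset Ω) ×ˢ S,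
      ((fun p => lp.evalCLM ℂ (fun _ : Fin d → ℤ => ℂ) 2 j
        (inner ℂ (gaborSystem B Ω u hu p) x • gaborSystem B Ω v hv p)) ∘
          (Equiv.refl Ω).prodCongr (Equiv.subLeft j)) q = 0 := by
    rintro ⟨m, t⟩ hq
    have ht : t ∉ S := by simpa using hq
    refine (hterm m t).trans (Finset.sum_eq_zero fun s _ => ?_)
    rw [hvS t ht]; ring
  have hfinite := hasSum_sum_of_ne_finset_zero (L := .unconditional _) hzero
  rw [Finset.sum_product, Finset.sum_comm] at hfinite
  have hinner : ∀ t ∈ S, ∑ m : Ω, lp.evalCLM ℂ (fun _ : Fin d → ℤ => ℂ) 2 j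
        (inner ℂ (gaborSystem B Ω u hu (m, j - t)) x • gaborSystem B Ω v hv (m, j - t))
      = v t * (starRingEnd ℂ) (u t) * x j * Fintype.card Ω := by
    intro t ht
    simp_rw [hterm]
    rw [Finset.sum_comm]
    simp_rw [← Finset.mul_sum]
    rw [Finset.sum_eq_single_of_mem t ht]
    · have h0 : toReal (t - t) = 0 := by ext i; simp [toReal]
      simp only [h0, dotProduct_zero, Complex.ofReal_zero, mul_zero, Complex.exp_zero,
        Finset.sum_const, Finset.card_univ, nsmul_eq_mul, mul_one, add_sub_cancel]
    · intro s hs hst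
      rw [horth s hs t ht hst, mul_zero]
  have htotal := Finset.sum_congr rfl hinner
  rw [← Finset.sum_mul, ← Finset.sum_mul, show (∑ t ∈ S, v t * (starRingEnd ℂ) (u t)) * x j *
    Fintype.card Ω = x j by linear_combination x j * huv] at htotal
  exact htotal ▸ hfinite

end Gabor

/-! ### The lattice `B⁻¹ℤ^d`: index and character orthogonality. -/

section Lattice

variable {d : ℕ}

theorem toReal_add (u v : Fin d → ℤ) : toReal (u + v) = toReal u + toReal v := by
  ext i; simp [toReal]

theorem toReal_dotProduct (u v : Fin d → ℤ) : toReal u ⬝ᵥ toReal v = ((u ⬝ᵥ v : ℤ) : ℝ) := by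
  simp [toReal, dotProduct]

theorem exp_int_eq_one (n : ℤ) :
    Complex.exp (2 * Real.pi * Complex.I * (((n : ℤ) : ℝ) : ℂ)) = 1 :=
  Complex.exp_eq_one_iff.2 ⟨n, by push_cast; ring⟩

theorem exists_intMatrix {B : Matrix (Fin d) (Fin d) ℝ} (hBint : ∀ i j, ∃ z : ℤ, B⁻¹ i j = (z : ℝ)) :
    ∃ A : Matrix (Fin d) (Fin d) ℤ, B⁻¹ = A.map ((↑) : ℤ → ℝ) := by
  choose A hA using hBint
  exact ⟨Matrix.of A, by ext i j; simp [hA]⟩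

theorem toReal_mulVec (A : Matrix (Fin d) (Fin d) ℤ) (k : Fin d → ℤ) :
    toReal (A.mulVec k) = (A.map ((↑) : ℤ → ℝ)).mulVec (toReal k) := by
  ext i; simp [toReal, Matrix.mulVec, dotProduct]

/-- The lattice is the image of the integer matrix `A = B⁻¹`, whose index in `ℤ^d` is `|det A|`. -/
theorem index_latticeSubgroup {B : Matrix (Fin d) (Fin d) ℝ} (hB : IsUnit B.det)
    (hBint : ∀ i j, ∃ z : ℤ, B⁻¹ i j = (z : ℝ)) :
    ((latticeSubgroup B).index : ℝ) * |B.det| = 1 := by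
  obtain ⟨A, hA⟩ := exists_intMatrix hBint
  have hdet : ((A.det : ℤ) : ℝ) = B.det⁻¹ := by
    have h := Matrix.det_nonsing_inv B
    rw [hA, Ring.inverse_eq_inv'] at h
    rw [← h]
    exact (Int.castRingHom ℝ).map_det A
  have hA0 : A.det ≠ 0 := by
    intro h
    rw [h, Int.cast_zero] at hdet
    exact inv_ne_zero hB.ne_zero hdet.symm
  have hinj : Function.Injective A.mulVecLin :=
    Matrix.mulVec_injective_of_det_ne_zero hA0
  have hL : latticeSubgroup B = A.mulVecLin.range.toAddSubgroup := by
    ext z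
    change (∃ k : Fin d → ℤ, toReal z = B⁻¹.mulVec (toReal k)) ↔ ∃ k, A.mulVecLin k = z
    refine exists_congr fun k => ?_
    rw [hA, ← toReal_mulVec, Matrix.mulVecLin_apply]
    constructor
    · intro h
      funext i
      have := congrFun h i
      simp only [toReal] at this
      exact_mod_cast this.symm
    · rintro rfl; rfl
  have h1 := Submodule.natAbs_det_equiv A.mulVecLin.range (LinearEquiv.ofInjective _ hinj)
  have h2 : (A.mulVecLin.range.subtype ∘ₗ
      ((LinearEquiv.ofInjective A.mulVecLin hinj : _ ≃ₗ[ℤ] _) : (Fin d → ℤ) →ₗ[ℤ] _)) =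
      Matrix.toLin' A := by
    ext; rfl
  have h3 : (latticeSubgroup B).index = A.det.natAbs := by
    rw [hL, ← LinearMap.det_toLin', ← h2]
    exact h1.symm
  rw [h3, Nat.cast_natAbs, Int.cast_abs, hdet, ← abs_mul, inv_mul_cancel₀ hB.ne_zero, abs_one]

/-- Modulations by points of `B⁻¹ℤ^d` are trivial on `ℤ^d`. -/
theorem exp_mem_latticeSubgroup {B : Matrix (Fin d) (Fin d) ℝ} (hB : IsUnit B.det)
    {m : Fin d → ℤ} (hm : m ∈ latticeSubgroup B) (l : Fin d → ℤ) :
    Complex.exp (2 * Real.pi * Complex.I * ((B.mulVec (toReal m) ⬝ᵥ toReal l : ℝ) : ℂ)) = 1 := by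
  obtain ⟨k, hk⟩ := hm
  rw [hk, Matrix.mulVec_mulVec, Matrix.mul_nonsing_inv _ hB, Matrix.one_mulVec, toReal_dotProduct]
  exact exp_int_eq_one _

theorem exp_add_modulation (B : Matrix (Fin d) (Fin d) ℝ) (m m' l : Fin d → ℤ) :
    Complex.exp (2 * Real.pi * Complex.I * ((B.mulVec (toReal (m + m')) ⬝ᵥ toReal l : ℝ) : ℂ))
    = Complex.exp (2 * Real.pi * Complex.I * ((B.mulVec (toReal m) ⬝ᵥ toReal l : ℝ) : ℂ)) *
      Complex.exp (2 * Real.pi * Complex.I * ((B.mulVec (toReal m') ⬝ᵥ toReal l : ℝ) : ℂ)) := by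
  rw [toReal_add, Matrix.mulVec_add, add_dotProduct, ← Complex.exp_add]
  push_cast
  ring_nf

/-- Some modulation is nontrivial at every nonzero point of the open cube. -/
theorem exists_modulation_ne_one {B : Matrix (Fin d) (Fin d) ℝ} (hB : IsUnit B.det) {N : ℕ}
    (hBsharp : ∀ n : Fin d → ℤ, n ≠ 0 → (B.transpose⁻¹).mulVec (toReal n) ∉ openCube d N)
    {l : Fin d → ℤ} (hl : l ≠ 0) (hlN : toReal l ∈ openCube d N) :
    ∃ m : Fin d → ℤ, Complex.exp
      (2 * Real.pi * Complex.I * ((B.mulVec (toReal m) ⬝ᵥ toReal l : ℝ) : ℂ)) ≠ 1 := by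
  by_contra! h
  -- If all modulations are trivial at `l`, the basis vectors show that `Bᵀ l` is an integer vector
  -- `k`; then `l = (Bᵀ)⁻¹ k` lies in the open cube, which forces `k = 0`.
  have h1 : ∀ i, ∃ n : ℤ, (B.transpose.mulVec (toReal l)) i = n := by
    intro i
    obtain ⟨n, hn⟩ := Complex.exp_eq_one_iff.1 (h (Pi.single i 1))
    refine ⟨n, ?_⟩
    have he : toReal (Pi.single i 1) = Pi.single i (1 : ℝ) := by
      ext j; by_cases hij : j = i
      · subst hij; simp [toReal]
      · simp [toReal, hij]
    have hpi : (2 * Real.pi * Complex.I : ℂ) ≠ 0 := Complex.two_pi_I_ne_zero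
    rw [mul_comm (n : ℂ)] at hn
    have h2 := mul_left_cancel₀ hpi hn
    rw [he, Matrix.mulVec_single_one] at h2
    exact_mod_cast h2
  choose k hk using h1
  have h2 : B.transpose.mulVec (toReal l) = toReal k := funext hk
  have h3 : (B.transpose⁻¹).mulVec (toReal k) = toReal l := by
    rw [← h2, Matrix.mulVec_mulVec, Matrix.nonsing_inv_mul _ (by rwa [Matrix.det_transpose]),
      Matrix.one_mulVec]
  by_cases hk0 : k = 0
  · apply hl
    have h0 : toReal (0 : Fin d → ℤ) = 0 := by ext i; simp [toReal]
    rw [hk0, h0, Matrix.mulVec_zero] at h3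
    funext i
    have := congrFun h3 i
    simp only [toReal, Pi.zero_apply] at this
    exact_mod_cast this.symm
  · exact hBsharp k hk0 (h3 ▸ hlN)

/-- Translating the cosets by some `m₀` with `φ m₀ ≠ 1` permutes `Ω` and multiplies the sum by `φ
m₀`. -/
theorem sum_modulation_eq_zero {B : Matrix (Fin d) (Fin d) ℝ} (hB : IsUnit B.det) {N : ℕ}
    (hBsharp : ∀ n : Fin d → ℤ, n ≠ 0 → (B.transpose⁻¹).mulVec (toReal n) ∉ openCube d N)
    {Ω : Set (Fin d → ℤ)} [Fintype Ω] (hΩ : IsCosetReps B Ω)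
    {l : Fin d → ℤ} (hl : l ≠ 0) (hlN : toReal l ∈ openCube d N) :
    ∑ m : Ω, Complex.exp (2 * Real.pi * Complex.I *
      ((B.mulVec (toReal (m : Fin d → ℤ)) ⬝ᵥ toReal l : ℝ) : ℂ)) = 0 := by
  obtain ⟨m₀, hm₀⟩ := exists_modulation_ne_one hB hBsharp hl hlN
  set φ : (Fin d → ℤ) → ℂ := fun m => Complex.exp
    (2 * Real.pi * Complex.I * ((B.mulVec (toReal m) ⬝ᵥ toReal l : ℝ) : ℂ))
  have hadd : ∀ m m', φ (m + m') = φ m * φ m' := fun m m' => exp_add_modulation B m m' l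
  let e := AddSubgroup.IsComplement.leftQuotientEquiv hΩ
  have he : ∀ q, ((e q : Fin d → ℤ) : (Fin d → ℤ) ⧸ latticeSubgroup B) = q :=
    AddSubgroup.IsComplement.quotientAddGroupMk_leftQuotientEquiv hΩ
  have hshift : ∀ m : Ω, φ (e (e.symm m + (m₀ : (Fin d → ℤ) ⧸ latticeSubgroup B))) =
      φ m * φ m₀ := by
    intro m
    -- The new representative differs from `m + m₀` by a lattice point, where `φ` is `1`.
    have hmem : -(m + m₀ : Fin d → ℤ) + e (e.symm m + (m₀ : (Fin d → ℤ) ⧸ latticeSubgroup B))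
        ∈ latticeSubgroup B := by
      rw [← QuotientAddGroup.eq, he, QuotientAddGroup.mk_add]
      congr 1
    rw [← hadd, ← mul_one (φ (m + m₀)), ← exp_mem_latticeSubgroup hB hmem l]
    change _ = φ _ * φ _
    rw [← hadd]
    congr 1
    abel
  have hinv : ∑ m : Ω, φ m = (∑ m : Ω, φ m) * φ m₀ := by
    rw [Finset.sum_mul, ← ((e.symm.trans
      (Equiv.addRight (m₀ : (Fin d → ℤ) ⧸ latticeSubgroup B))).trans e).sum_comp fun m => φ m]
    exact Finset.sum_congr rfl fun m _ => hshift m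
  have h0 : (∑ m : Ω, φ m) * (φ m₀ - 1) = 0 := by rw [mul_sub, ← hinv, mul_one, sub_self]
  exact (mul_eq_zero.1 h0).resolve_right (sub_ne_zero.2 hm₀)

theorem IsCosetReps.finite {B : Matrix (Fin d) (Fin d) ℝ} (hB : IsUnit B.det)
    (hBint : ∀ i j, ∃ z : ℤ, B⁻¹ i j = (z : ℝ)) {Ω : Set (Fin d → ℤ)} (hΩ : IsCosetReps B Ω) :
    Finite Ω := by
  have h := index_latticeSubgroup hB hBint
  have h0 : Nat.card Ω ≠ 0 := by
    rw [AddSubgroup.IsComplement.card_left hΩ]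
    rintro h'
    simp [h'] at h
  exact Nat.finite_of_card_ne_zero h0

/-! ### Character sums over a period, and the windows on the box. -/

/-- Sum of a one-dimensional character over a period. -/
theorem sum_exp_Ico {N : ℕ} (hN : 1 ≤ N) (k : ℤ) :
    ∑ a ∈ Finset.Ico (0 : ℤ) N, Complex.exp (2 * Real.pi * Complex.I * (k * a) / N)
      = if (N : ℤ) ∣ k then (N : ℂ) else 0 := by
  have hN0 : (N : ℂ) ≠ 0 := by exact_mod_cast (by omega : N ≠ 0)
  set z := Complex.exp (2 * Real.pi * Complex.I * k / N) with hz
  have h1 : ∑ a ∈ Finset.Ico (0 : ℤ) N, Complex.exp (2 * Real.pi * Complex.I * (k * a) / N)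
      = ∑ a ∈ Finset.range N, z ^ a := by
    symm
    refine Finset.sum_nbij' (fun a => (a : ℤ)) Int.toNat ?_ ?_ ?_ ?_ ?_
    · intro a ha; simp at ha ⊢; omega
    · intro a ha; simp at ha ⊢; omega
    · intro a ha; simp
    · intro a ha; simp at ha ⊢; omega
    · intro a _
      rw [hz, ← Complex.exp_nat_mul]
      congr 1; push_cast; ring
  rw [h1]
  have hzN : z ^ N = 1 := by
    rw [hz, ← Complex.exp_nat_mul, Complex.exp_eq_one_iff]
    exact ⟨k, by field_simp⟩
  have hz1 : z = 1 ↔ (N : ℤ) ∣ k := by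
    rw [hz, Complex.exp_eq_one_iff]
    have hpi := Complex.two_pi_I_ne_zero
    constructor
    · rintro ⟨n, hn⟩
      refine ⟨n, ?_⟩
      rw [div_eq_iff hN0] at hn
      have h2 : (k : ℂ) = N * n := mul_left_cancel₀ hpi (by rw [hn]; ring)
      exact_mod_cast h2
    · rintro ⟨n, rfl⟩
      exact ⟨n, by push_cast; field_simp⟩
  split_ifs with h
  · simp [hz1.2 h]
  · have hne : z ≠ 1 := fun h' => h (hz1.1 h')
    rw [geom_sum_eq hne, hzN, sub_self, zero_div]

/-- The integer points of the half-open cube `[0,N)^d`. -/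
def box (d N : ℕ) : Finset (Fin d → ℤ) := Fintype.piFinset fun _ => Finset.Ico (0 : ℤ) N

theorem mem_box {N : ℕ} {j : Fin d → ℤ} : j ∈ box d N ↔ ∀ i, 0 ≤ j i ∧ j i < N := by
  simp [box]

theorem sum_trigChar_box {N : ℕ} (hN : 1 ≤ N) (k : Fin d → ℤ) :
    ∑ j ∈ box d N, trigChar N k (toReal j) = if ∀ i, (N : ℤ) ∣ k i then (N : ℂ) ^ d else 0 := by
  have h1 : ∀ j : Fin d → ℤ, trigChar N k (toReal j)
      = ∏ i, Complex.exp (2 * Real.pi * Complex.I * (k i * j i) / N) := by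
    intro j
    rw [trigChar, ← Complex.exp_sum]
    congr 1
    rw [← Finset.sum_div, ← Finset.mul_sum]
    simp [dotProduct, toReal]
  simp_rw [h1]
  rw [box, ← Finset.prod_univ_sum (fun _ => Finset.Ico (0 : ℤ) N)
    fun i a => Complex.exp (2 * Real.pi * Complex.I * (k i * a) / N)]
  simp_rw [sum_exp_Ico hN]
  split_ifs with h
  · simp [h]
  · push Not at h
    obtain ⟨i, hi⟩ := h
    exact Finset.prod_eq_zero (Finset.mem_univ i) (if_neg hi)

/-- Summation over the box kills all frequencies outside `(Nℤ)^d`; among the rest only `k = 0` has a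
nonzero coefficient, contributing `N^(-d) * N^d`. -/
theorem sum_box_eq_one {N : ℕ} (hN : 1 ≤ N) {s : Finset (Fin d → ℤ)} (h0 : 0 ∈ s)
    {P : (Fin d → ℝ) → ℝ} {c : (Fin d → ℤ) → ℂ}
    (hP : ∀ x, (P x : ℂ) = ∑ k ∈ s, c k * trigChar N k x)
    (hc : ∀ k ∈ s, (∀ i, (N : ℤ) ∣ k i) → c k = if k = 0 then 1 / (N : ℂ) ^ d else 0) :
    ∑ j ∈ box d N, P (toReal j) = 1 := by
  have hN0 : (N : ℂ) ≠ 0 := by exact_mod_cast (by omega : N ≠ 0)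
  have h : ∑ j ∈ box d N, (P (toReal j) : ℂ) = 1 := by
    simp_rw [hP]
    rw [Finset.sum_comm]
    simp_rw [← Finset.mul_sum, sum_trigChar_box hN]
    rw [Finset.sum_eq_single_of_mem 0 h0]
    · rw [hc 0 h0 (by simp)]
      simp [hN0]
    · intro k hk hk0
      split_ifs with hd
      · rw [hc k hk hd, if_neg hk0, zero_mul]
      · rw [mul_zero]
  exact_mod_cast h

theorem window_eq_zero_of_notMem_box {M N : ℕ} (hN : 1 ≤ N) (hM : 1 ≤ M) (F : (Fin d → ℝ) → ℝ)
    {j : Fin d → ℤ} (hj : j ∉ box d N) : window M N F (toReal j) = 0 := by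
  by_cases hc : toReal j ∈ cube d N
  · rw [window, Set.indicator_of_mem hc]
    rw [mem_box] at hj
    push Not at hj
    obtain ⟨i, hi⟩ := hj
    have h1 : (0 : ℝ) ≤ j i := (hc i).1
    have h2 : ((j i : ℤ) : ℝ) ≤ N := (hc i).2
    -- An integer point of the closed cube outside the box has a coordinate `N`, where the sine
    -- vanishes; `1 ≤ M` keeps its power zero.
    have h3 : j i = N := le_antisymm (by exact_mod_cast h2) (hi (by exact_mod_cast h1))
    have hN0 : (N : ℝ) ≠ 0 := by exact_mod_cast (by omega : N ≠ 0)
    have h4 : Real.sin (Real.pi * toReal j i / N) = 0 := by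
      simp [toReal, h3, hN0]
    rw [Finset.prod_eq_zero (Finset.mem_univ i) (by rw [h4, zero_pow (by omega)]), zero_mul]
  · rw [window, Set.indicator_of_notMem hc]

theorem window_mul_window {M N : ℕ} {P G H : (Fin d → ℝ) → ℝ}
    (hfac : ∀ x, P x = (∏ i, Real.sin (Real.pi * x i / N) ^ (2 * M)) * G x * H x)
    {j : Fin d → ℤ} (hj : j ∈ box d N) :
    window M N G (toReal j) * window M N H (toReal j) = P (toReal j) := by
  have hc : toReal j ∈ cube d N := fun i =>
    ⟨by simpa [toReal] using (mem_box.1 hj i).1, by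
      have := (mem_box.1 hj i).2.le
      simp only [toReal]; exact_mod_cast this⟩
  rw [window, window, Set.indicator_of_mem hc, Set.indicator_of_mem hc, hfac]
  simp_rw [pow_mul', pow_two]
  rw [Finset.prod_mul_distrib]
  ring

theorem memℓp_of_finset_support {p : ℝ≥0∞} {u : (Fin d → ℤ) → ℂ} {S : Finset (Fin d → ℤ)}
    (hu : ∀ j ∉ S, u j = 0) : Memℓp u p :=
  (memℓp_zero (S.finite_toSet.subset fun j hj => by
    by_contra h
    exact hj (hu j h))).of_exponent_ge zero_le

theorem toReal_sub_mem_openCube {N : ℕ} {s t : Fin d → ℤ} (hs : s ∈ box d N) (ht : t ∈ box d N) :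
    toReal (t - s) ∈ openCube d N := fun i => by
  have h1 := mem_box.1 hs i
  have h2 := mem_box.1 ht i
  have h3 : -(N : ℤ) < (t - s) i := by simp only [Pi.sub_apply]; omega
  have h4 : (t - s) i < (N : ℤ) := by simp only [Pi.sub_apply]; omega
  simp only [toReal]
  exact ⟨by exact_mod_cast h3, by exact_mod_cast h4⟩

/-- Windows supported in `[0,N)^d` whose pairing is `|det B|` generate dual Gabor frames. -/
theorem isDualFrames_gaborSystem {B : Matrix (Fin d) (Fin d) ℝ} (hB : IsUnit B.det) {N : ℕ}
    (hBsharp : ∀ n : Fin d → ℤ, n ≠ 0 → (B.transpose⁻¹).mulVec (toReal n) ∉ openCube d N)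
    (hBint : ∀ i j, ∃ z : ℤ, B⁻¹ i j = (z : ℝ)) {u v : (Fin d → ℤ) → ℂ}
    (hu : Memℓp u 2) (hv : Memℓp v 2)
    (huS : ∀ j ∉ box d N, u j = 0) (hvS : ∀ j ∉ box d N, v j = 0)
    (huv : ∑ s ∈ box d N, v s * (starRingEnd ℂ) (u s) = (|B.det| : ℝ))
    {Ω : Set (Fin d → ℤ)} (hΩ : IsCosetReps B Ω) :
    IsDualFrames (gaborSystem B Ω u hu) (gaborSystem B Ω v hv) := by
  have hfin := hΩ.finite hB hBint
  have := Fintype.ofFinite Ω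
  have hcard : (Fintype.card Ω : ℂ) * (|B.det| : ℝ) = 1 := by
    have h := index_latticeSubgroup hB hBint
    rw [← AddSubgroup.IsComplement.card_left hΩ, Nat.card_eq_fintype_card] at h
    exact_mod_cast h
  have horth : ∀ s ∈ box d N, ∀ t ∈ box d N, s ≠ t →
      ∑ m : Ω, Complex.exp (2 * Real.pi * Complex.I *
        ((B.mulVec (toReal (m : Fin d → ℤ)) ⬝ᵥ toReal (t - s) : ℝ) : ℂ)) = 0 :=
    fun s hs t ht hst => sum_modulation_eq_zero hB hBsharp hΩ (sub_ne_zero.2 hst.symm)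
      (toReal_sub_mem_openCube hs ht)
  have hvu : ∑ s ∈ box d N, u s * (starRingEnd ℂ) (v s) = (|B.det| : ℝ) := by
    have h := congrArg (starRingEnd ℂ) huv
    simpa [map_sum, mul_comm] using h
  have h1 := hasSum_gaborSystem B Ω hu hv huS hvS horth (by rw [huv, hcard])
  have h2 := hasSum_gaborSystem B Ω hv hu hvS huS horth (by rw [hvu, hcard])
  obtain ⟨b, hb⟩ := isBessel_gaborSystem B Ω hu huS
  obtain ⟨b', hb'⟩ := isBessel_gaborSystem B Ω hv hvS
  exact ⟨hb.isFrame hb' h1, hb'.isFrame hb h2, h1, h2⟩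

end Lattice

end DiscreteGabor

end

theorem corollary5p1 {d : ℕ} (hd : 1 ≤ d) (K N M : ℕ) (hK : 1 ≤ K) (hN : 1 ≤ N) (hM : 1 ≤ M)
    (hMK : M ≤ K)
    (P : (Fin d → ℝ) → ℝ) (c : (Fin d → ℤ) → ℂ)
    (hP : ∀ x, (P x : ℂ) = ∑ k ∈ Finset.Icc (fun _ : Fin d => -(K : ℤ)) (fun _ => (K : ℤ)),
      c k * DiscreteGabor.trigChar N k x)
    (hc : ∀ k ∈ Finset.Icc (fun _ : Fin d => -(K : ℤ)) (fun _ => (K : ℤ)),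
      (∀ i, (N : ℤ) ∣ k i) → c k = if k = 0 then 1 / (N : ℂ) ^ d else 0)
    (hPsmooth : ContDiff ℝ ((2 * M - 1 : ℕ)) ((DiscreteGabor.cube d N).indicator P))
    (G H : (Fin d → ℝ) → ℝ)
    (hG : DiscreteGabor.IsRealTrigPoly N G) (hH : DiscreteGabor.IsRealTrigPoly N H)
    (hfac : ∀ x, P x = (∏ i, Real.sin (Real.pi * x i / N) ^ (2 * M)) * G x * H x)
    (B : Matrix (Fin d) (Fin d) ℝ) (hB : IsUnit B.det)
    (hBsharp : ∀ n : Fin d → ℤ, n ≠ 0 →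
      (B.transpose⁻¹).mulVec (DiscreteGabor.toReal n) ∉ DiscreteGabor.openCube d N)
    (hBint : ∀ i j, ∃ z : ℤ, B⁻¹ i j = (z : ℝ)) :
    ∃ (hg : Memℓp (DiscreteGabor.samples (DiscreteGabor.window M N G)) 2)
      (hh : Memℓp (DiscreteGabor.samples
        (fun x => |B.det| * DiscreteGabor.window M N H x)) 2),
      ∀ Ω : Set (Fin d → ℤ), DiscreteGabor.IsCosetReps B Ω →
        DiscreteGabor.IsDualFrames
          (DiscreteGabor.gaborSystem B Ω
            (DiscreteGabor.samples (DiscreteGabor.window M N G)) hg)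
          (DiscreteGabor.gaborSystem B Ω
            (DiscreteGabor.samples (fun x => |B.det| * DiscreteGabor.window M N H x)) hh) := by
  have hgS : ∀ j ∉ DiscreteGabor.box d N,
      DiscreteGabor.samples (DiscreteGabor.window M N G) j = 0 := fun j hj => by
    rw [DiscreteGabor.samples, DiscreteGabor.window_eq_zero_of_notMem_box hN hM G hj,
      Complex.ofReal_zero]
  have hhS : ∀ j ∉ DiscreteGabor.box d N,
      DiscreteGabor.samples (fun x => |B.det| * DiscreteGabor.window M N H x) j = 0 :=
    fun j hj => by
      rw [DiscreteGabor.samples, DiscreteGabor.window_eq_zero_of_notMem_box hN hM H hj, mul_zero,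
        Complex.ofReal_zero]
  refine ⟨DiscreteGabor.memℓp_of_finset_support hgS, DiscreteGabor.memℓp_of_finset_support hhS,
    fun Ω hΩ => DiscreteGabor.isDualFrames_gaborSystem hB hBsharp hBint _ _ hgS hhS ?_ hΩ⟩
  have hsum := DiscreteGabor.sum_box_eq_one hN
    (Finset.mem_Icc.2 ⟨fun _ => by simp, fun _ => by simp⟩) hP hc
  have hreal : ∑ j ∈ DiscreteGabor.box d N,
      |B.det| * DiscreteGabor.window M N H (DiscreteGabor.toReal j) *
        DiscreteGabor.window M N G (DiscreteGabor.toReal j) = |B.det| := by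
    refine Eq.trans ?_ ((congrArg (|B.det| * ·) hsum).trans (mul_one _))
    simp only [Finset.mul_sum]
    refine Finset.sum_congr rfl fun j hj => ?_
    rw [← DiscreteGabor.window_mul_window hfac hj]
    ring
  conv_rhs => rw [← hreal]
  simp only [DiscreteGabor.samples, Complex.conj_ofReal]
  push_cast
  rfl
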